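/- **Theorem (Cantor spectrum).** Let $\mathcal A$ be a unital $C^*$-algebra and $\mathcal E$ a Hilbert $\mathcal A$-module. Let $\mathcal L_{\mathcal A}(\mathcal E)$ be the $C^*$-algebra of adjointable operators on $\mathcal E$ and $\mathcal K_{\mathcal A}(\mathcal E)\subseteq\mathcal L_{\mathcal A}(\mathcal E)$ the $C^*$-algebra of $\mathcal A$-compact operators, i.e. the norm closure of the span of the operators $z\mapsto x\langle y|z\rangle$, $x,y\in\mathcal E$. Assume that $\mathcal K_{\mathcal A}(\mathcal E)$ has real rank $0$ with infinitesimal state ($RRI_0$): there is a faithful state $\Phi$ on $\mathcal K_{\mathcal A}(\mathcal E)$ such that for every self-adjoint $x\in\mathcal K_{\mathcal A}(\mathcal E)$ and every $\varepsilon>0$ there is a self-adjoint $y\in\mathcal K_{\mathcal A}(\mathcal E)$ with finite spectrum, $\|x-y\|<\varepsilon$, and $\Phi(p)<\varepsilon$ for every minimal spectral projection $p\in\mathcal K_{\mathcal A}(\mathcal E)$ of $y$ (the spectral projection at a single point of the spectrum). Let $D$ be a self-adjoint $\mathcal A$-elliptic operator on $\mathcal E$ with $\operatorname{spec} D\neq\mathbb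 R$. Here an operator $D$ is $\mathcal A$-elliptic if it is densely defined, its adjoint $D^*$ is densely defined, $1+D^*D$ has dense range, and $(1+D^*D)^{-1}\in\mathcal K_{\mathcal A}(\mathcal E)$; $D$ is self-adjoint if $D=D^*$; and $\operatorname{spec}D$ is the set of $z\in\mathbb C$ for which $D-z$ has no inverse in $\mathcal L_{\mathcal A}(\mathcal E)$. Then $D$ can be approximated arbitrarily well, in norm resolvent sense, by self-adjoint $\mathcal A$-elliptic operators with Cantor spectrum. That is, there are self-adjoint $\mathcal A$-elliptic operators $T_n$ on $\mathcal E$ ($n\in\mathbb N$), each of which has a spectrum that is contained in $\mathbb R$, is nowhere dense in $\mathbb R$ and has no isolated points, such that $\|(T_n-z)^{-1}-(D-z)^{-1}\|\to0$ for every $z\in\mathbb C\setminus\mathbb R$. -/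

import Mathlib

open Filter Topology
open scoped ComplexOrder

noncomputable section

namespace CantorBloch

/-! ### Cantor sets and real rank zero with infinitesimal state -/

/-- A Cantor set: nowhere dense and without isolated points. -/
def IsCantorSet {X : Type*} [TopologicalSpace X] (S : Set X) : Prop :=
  IsNowhereDense S ∧ Preperfect S

/-- A faithful state on a (not necessarily unital) C⋆-algebra. -/
structure IsFaithfulState {K : Type*} [NonUnitalCStarAlgebra K] (Φ : K →L[ℂ] ℂ) : Prop where
  nonneg : ∀ a : K, 0 ≤ Φ (star a * a)
  norm_eq_one : ‖Φ‖ = 1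
  faithful : ∀ a : K, Φ (star a * a) = 0 → a = 0

/-- `p ∈ K` is the spectral projection of `y` at the point `t`, that is, the projection onto the
`t`-eigenspace of `y`. For a self-adjoint `y` with finite spectrum this is `χ_{t}(y)` whenever that
projection lies in `K` (always if `t ≠ 0`; for `t = 0` if and only if `K` is unital), and there is
no such `p` otherwise. The nonzero ones are the minimal spectral projections of `y`. -/
def IsSpectralProjectionAt {K : Type*} [NonUnitalCStarAlgebra K] (y : K) (t : ℝ) (p : K) : Prop :=
  IsStarProjection p ∧ ∀ z : K, y * z = (t : ℂ) • z ↔ p * z = z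

/-- Real rank zero with infinitesimal state: for some faithful state, every self-adjoint element
can be approximated arbitrarily well by self-adjoint elements with finite spectrum on whose minimal
spectral projections the state is arbitrarily small.
(The quasispectrum is the spectrum in the unitization, up to adding the point `0`.) -/
def HasRRI0 (K : Type*) [NonUnitalCStarAlgebra K] : Prop :=
  ∃ Φ : K →L[ℂ] ℂ, IsFaithfulState Φ ∧
    ∀ x : K, IsSelfAdjoint x → ∀ ε : ℝ, 0 < ε →
      ∃ y : K, IsSelfAdjoint y ∧ ‖x - y‖ < ε ∧ (quasispectrum ℂ y).Finite ∧
        ∀ (t : ℝ) (p : K), p ≠ 0 → IsSpectralProjectionAt y t p → ‖Φ p‖ < ε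

/-! Hilbert `A`-modules are Mathlib's `CStarModule`: complete, the inner product is linear in the second
entry, and the scalars of `A` are written on the left, `⟨x, a • y⟩ = a * ⟨x, y⟩`. Passing to the
opposite algebra turns these into right Hilbert modules and conversely. -/

section Module

set_option linter.unusedSectionVars false

variable (A : Type*) {E : Type*} [CStarAlgebra A] [PartialOrder A] [StarOrderedRing A]
  [NormedAddCommGroup E] [NormedSpace ℂ E] [Module A E] [CStarModule A E]

theorem ext_inner {x y : E} (h : ∀ z : E, inner A z x = inner A z y) : x = y := by
  rw [← sub_eq_zero, ← CStarModule.inner_self (A := A), CStarModule.inner_sub_right, h, sub_self]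

/-! ### Bounded adjointable operators -/

theorem norm_smul_le' (a : A) (x : E) : ‖a • x‖ ≤ ‖a‖ * ‖x‖ := by
  have h : ‖a • x‖ ^ 2 ≤ (‖a‖ * ‖x‖) ^ 2 := by
    rw [CStarModule.norm_sq_eq A, CStarModule.inner_op_smul_right, CStarModule.inner_op_smul_left]
    calc ‖a * (inner A x x * star a)‖ ≤ ‖a‖ * (‖inner A x x‖ * ‖star a‖) :=
          (norm_mul_le _ _).trans (by gcongr; exact norm_mul_le _ _)
      _ = (‖a‖ * ‖x‖) ^ 2 := by
          rw [norm_star, mul_pow, CStarModule.norm_sq_eq A (x := x)]; ring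
  exact (pow_le_pow_iff_left₀ (norm_nonneg _) (by positivity) two_ne_zero).mp h

/-- `S` is an adjoint of the bounded operator `T`. -/
def IsAdjointOf (S T : E →L[ℂ] E) : Prop :=
  ∀ x y : E, inner A (T x) y = inner A x (S y)

variable {A} in
theorem IsAdjointOf.unique {S S' T : E →L[ℂ] E} (h : IsAdjointOf A S T)
    (h' : IsAdjointOf A S' T) : S = S' := by
  ext y
  exact ext_inner A fun x => by rw [← h, ← h']

variable {A} in
theorem IsAdjointOf.symm {S T : E →L[ℂ] E} (h : IsAdjointOf A S T) : IsAdjointOf A T S := by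
  intro x y
  rw [← CStarModule.star_inner, ← h, CStarModule.star_inner]

variable {A} in
theorem IsAdjointOf.norm_sq_le {S T : E →L[ℂ] E} (h : IsAdjointOf A S T) :
    ‖T‖ * ‖T‖ ≤ ‖S * T‖ := by
  have key : ‖T‖ ≤ √‖S * T‖ := by
    refine T.opNorm_le_bound (Real.sqrt_nonneg _) fun x => ?_
    have h1 : ‖T x‖ ^ 2 ≤ ‖S * T‖ * ‖x‖ ^ 2 := by
      rw [CStarModule.norm_sq_eq A, h]
      calc ‖inner A x (S (T x))‖ ≤ ‖x‖ * ‖(S * T) x‖ := CStarModule.norm_inner_le E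
        _ ≤ ‖x‖ * (‖S * T‖ * ‖x‖) := by gcongr; exact (S * T).le_opNorm x
        _ = ‖S * T‖ * ‖x‖ ^ 2 := by ring
    refine (pow_le_pow_iff_left₀ (norm_nonneg _) (by positivity) two_ne_zero).mp ?_
    rw [mul_pow, Real.sq_sqrt (norm_nonneg _)]
    exact h1
  calc ‖T‖ * ‖T‖ ≤ √‖S * T‖ * √‖S * T‖ := by gcongr
    _ = ‖S * T‖ := Real.mul_self_sqrt (norm_nonneg _)

variable {A} in
theorem IsAdjointOf.norm_le {S T : E →L[ℂ] E} (h : IsAdjointOf A S T) : ‖T‖ ≤ ‖S‖ := by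
  rcases eq_or_lt_of_le (norm_nonneg T) with h0 | h0
  · rw [← h0]; exact norm_nonneg S
  · exact le_of_mul_le_mul_right (h.norm_sq_le.trans (norm_mul_le S T)) h0

variable (E) in
/-- The algebra `𝓛_A(E)` of adjointable operators. -/
def adjointable : Subalgebra ℂ (E →L[ℂ] E) where
  carrier := {T | ∃ S, IsAdjointOf A S T}
  mul_mem' := by
    rintro T T' ⟨S, h⟩ ⟨S', h'⟩
    exact ⟨S' * S, fun x y => by
      rw [mul_apply_eq_comp, mul_apply_eq_comp, h, h']⟩
  add_mem' := by
    rintro T T' ⟨S, h⟩ ⟨S', h'⟩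
    exact ⟨S + S', fun x y => by
      rw [_root_.add_apply, _root_.add_apply,
        CStarModule.inner_add_left, CStarModule.inner_add_right, h, h']⟩
  algebraMap_mem' c := ⟨star c • 1, fun x y => by
    simp [Algebra.algebraMap_eq_smul_one]⟩

instance : Star (adjointable A E) where
  star T := ⟨T.2.choose, T.1, T.2.choose_spec.symm⟩

theorem star_spec (T : adjointable A E) :
    IsAdjointOf A (star T : adjointable A E).1 T.1 := T.2.choose_spec

variable {A} in
theorem star_eq_of {T S : adjointable A E} (h : IsAdjointOf A S.1 T.1) : star T = S :=
  Subtype.ext ((star_spec A T).unique h)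

instance : StarRing (adjointable A E) where
  star_involutive T := star_eq_of (star_spec A T).symm
  star_mul T T' := star_eq_of fun x y => by
    change inner A (T.1 (T'.1 x)) y = inner A x ((star T').1 ((star T).1 y))
    rw [star_spec A T, star_spec A T']
  star_add T T' := star_eq_of fun x y => by
    change inner A (T.1 x + T'.1 x) y = inner A x ((star T).1 y + (star T').1 y)
    rw [CStarModule.inner_add_left, CStarModule.inner_add_right, star_spec A T, star_spec A T']

instance : StarModule ℂ (adjointable A E) where
  star_smul c T := star_eq_of fun x y => by
    change inner A (c • T.1 x) y = inner A x (star c • (star T).1 y)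
    rw [CStarModule.inner_smul_left_complex, CStarModule.inner_smul_right_complex,
      star_spec A T]

instance : CStarRing (adjointable A E) where
  norm_mul_self_le T := (star_spec A T).norm_sq_le

/-! ### `A`-compact operators -/

/-- The operator `z ↦ x⟨y, z⟩` as a bounded operator (scalars of `A` are written on the left). -/
def rankOneCLM (x y : E) : E →L[ℂ] E :=
  LinearMap.mkContinuous
    { toFun := fun z => inner A y z • x
      map_add' := fun z w => by rw [CStarModule.inner_add_right, add_smul]
      map_smul' := fun c z => ext_inner A fun w => by simp }
    (‖x‖ * ‖y‖) fun z => by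
      calc ‖inner A y z • x‖ ≤ ‖inner A y z‖ * ‖x‖ := norm_smul_le' A _ _
        _ ≤ (‖y‖ * ‖z‖) * ‖x‖ := by gcongr; exact CStarModule.norm_inner_le E
        _ = ‖x‖ * ‖y‖ * ‖z‖ := by ring

theorem isAdjointOf_rankOneCLM (x y : E) :
    IsAdjointOf A (rankOneCLM A y x) (rankOneCLM A x y) := fun z w => by
  change inner A (inner A y z • x) w = inner A z (inner A x w • y)
  simp

/-- The operator `z ↦ x⟨y, z⟩` as an element of `𝓛_A(E)`. -/
def rankOne (x y : E) : adjointable A E :=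
  ⟨rankOneCLM A x y, rankOneCLM A y x, isAdjointOf_rankOneCLM A x y⟩

theorem rankOne_apply (x y z : E) : (rankOne A x y).1 z = inner A y z • x := rfl

theorem star_rankOne (x y : E) : star (rankOne A x y) = rankOne A y x :=
  star_eq_of (isAdjointOf_rankOneCLM A x y)

theorem mul_rankOne (T : adjointable A E) (x y : E) :
    T * rankOne A x y = rankOne A (T.1 x) y := by
  refine Subtype.ext (ContinuousLinearMap.ext fun z => ext_inner A fun w => ?_)
  change inner A w (T.1 (inner A y z • x)) = inner A w (inner A y z • T.1 x)
  have h := (star_spec A T).symm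
  rw [← h, CStarModule.inner_op_smul_right, CStarModule.inner_op_smul_right, h]

variable (E) in
/-- The `A`-finite operators `𝓕_A(E)`. -/
def finiteOps : NonUnitalStarSubalgebra ℂ (adjointable A E) where
  toSubmodule := Submodule.span ℂ {T | ∃ x y : E, T = rankOne A x y}
  mul_mem' := by
    intro T T' _ hT'
    change T * T' ∈ Submodule.span ℂ _
    change T' ∈ Submodule.span ℂ _ at hT'
    induction hT' using Submodule.span_induction with
    | mem R hR =>
      obtain ⟨x, y, rfl⟩ := hR
      exact Submodule.subset_span ⟨T.1 x, y, mul_rankOne A T x y⟩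
    | zero => rw [mul_zero]; exact Submodule.zero_mem _
    | add R R' _ _ h h' => rw [mul_add]; exact Submodule.add_mem _ h h'
    | smul c R _ h => rw [mul_smul_comm]; exact Submodule.smul_mem _ c h
  star_mem' := by
    intro T hT
    change star T ∈ Submodule.span ℂ _
    change T ∈ Submodule.span ℂ _ at hT
    induction hT using Submodule.span_induction with
    | mem R hR =>
      obtain ⟨x, y, rfl⟩ := hR
      exact Submodule.subset_span ⟨y, x, star_rankOne A x y⟩
    | zero => rw [star_zero]; exact Submodule.zero_mem _
    | add R R' _ _ h h' => rw [star_add]; exact Submodule.add_mem _ h h'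
    | smul c R _ h => rw [star_smul]; exact Submodule.smul_mem _ (star c) h

/-! ### Completeness -/

variable [CompleteSpace E]

theorem isClosed_adjointable : IsClosed (adjointable A E : Set (E →L[ℂ] E)) := by
  refine isClosed_of_closure_subset fun T hT => ?_
  obtain ⟨u, hu, hlim⟩ := mem_closure_iff_seq_limit.mp hT
  choose S hS using hu
  have hS' : CauchySeq S := by
    have hc := hlim.cauchySeq
    rw [Metric.cauchySeq_iff] at hc ⊢
    intro ε hε
    obtain ⟨N, hN⟩ := hc ε hε
    refine ⟨N, fun m hm n hn => lt_of_le_of_lt ?_ (hN m hm n hn)⟩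
    rw [dist_eq_norm, dist_eq_norm]
    refine IsAdjointOf.norm_le (A := A) fun x y => ?_
    rw [_root_.sub_apply, _root_.sub_apply,
      CStarModule.inner_sub_left, CStarModule.inner_sub_right, (hS m).symm, (hS n).symm]
  obtain ⟨S₀, hS₀⟩ := cauchySeq_tendsto_of_complete hS'
  refine ⟨S₀, fun x y => ?_⟩
  have e1 : Tendsto (fun n => inner A (u n x) y) atTop (𝓝 (inner A (T x) y)) := by
    have : Continuous fun R : E →L[ℂ] E => inner A (R x) y :=
      CStarModule.continuous_inner.comp
        ((ContinuousLinearMap.apply ℂ E x).continuous.prodMk continuous_const)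
    exact (this.tendsto T).comp hlim
  have e2 : Tendsto (fun n => inner A x (S n y)) atTop (𝓝 (inner A x (S₀ y))) := by
    have : Continuous fun R : E →L[ℂ] E => inner A x (R y) :=
      CStarModule.continuous_inner.comp
        (continuous_const.prodMk (ContinuousLinearMap.apply ℂ E y).continuous)
    exact (this.tendsto S₀).comp hS₀
  exact tendsto_nhds_unique (e1.congr fun n => hS n x y) e2

instance : CompleteSpace (adjointable A E) := (isClosed_adjointable A).completeSpace_coe

instance : CStarAlgebra (adjointable A E) where

variable (E) in
/-- The `A`-compact operators `𝓚_A(E)`, the norm closure of `𝓕_A(E)` in `𝓛_A(E)`. -/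
def compactOps : NonUnitalStarSubalgebra ℂ (adjointable A E) :=
  (finiteOps A E).topologicalClosure

instance : IsClosed (compactOps A E : Set (adjointable A E)) :=
  (finiteOps A E).isClosed_topologicalClosure

instance : NonUnitalCStarAlgebra (compactOps A E) :=
  NonUnitalStarSubalgebra.nonUnitalCStarAlgebra (compactOps A E)

/-! ### Unbounded operators -/

variable {A}

/-- `y` belongs to the domain of the adjoint `D*` and `D* y = z` (for densely defined `D`). -/
def AdjointRel (D : E →ₗ.[A] E) (y z : E) : Prop :=
  ∀ x : D.domain, inner A (D x) y = inner A (x : E) z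

/-- The densely defined operator `D` equals its adjoint: the graphs of `D*` and `D` coincide. -/
def IsSelfAdjointOp (D : E →ₗ.[A] E) : Prop :=
  Dense (D.domain : Set E) ∧ ∀ y z : E, AdjointRel D y z ↔ (y, z) ∈ D.graph

/-- `A`-elliptic operators: densely defined, with densely defined adjoint and `ran (1 + D*D)` dense,
and such that `(1 + D*D)⁻¹` is (on the dense subspace `ran (1 + D*D)`, where it is defined) given
by an `A`-compact operator. -/
structure IsElliptic (D : E →ₗ.[A] E) : Prop where
  dense_domain : Dense (D.domain : Set E)
  dense_adjoint_domain : Dense {y : E | ∃ z, AdjointRel D y z}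
  dense_range : Dense {w : E | ∃ (x : D.domain) (z : E), AdjointRel D (D x) z ∧ (x : E) + z = w}
  compact_resolvent : ∃ k ∈ compactOps A E,
    ∀ (x : D.domain) (z : E), AdjointRel D (D x) z → k.1 ((x : E) + z) = x

/-- `R = (D - z)⁻¹` in `𝓛_A(E)`. -/
def IsResolventAt (D : E →ₗ.[A] E) (z : ℂ) (R : adjointable A E) : Prop :=
  (∀ x : D.domain, R.1 (D x - z • (x : E)) = x) ∧
    ∀ y : E, ∃ x : D.domain, (x : E) = R.1 y ∧ D x - z • (x : E) = y

/-- The spectrum: the points at which `D` has no resolvent in `𝓛_A(E)`. -/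
def spec (D : E →ₗ.[A] E) : Set ℂ :=
  {z | ¬ ∃ R : adjointable A E, IsResolventAt D z R}

/-- The spectrum as a subset of the real line, `spec D ∩ ℝ`; for self-adjoint elliptic operators
this is the whole spectrum. -/
def realSpec (D : E →ₗ.[A] E) : Set ℝ :=
  {t | (t : ℂ) ∈ spec D}

/-- `T n → D` in norm resolvent sense: `(T n - z)⁻¹ → (D - z)⁻¹` in norm for all non-real `z`. -/
def NormResolventTendsto (T : ℕ → E →ₗ.[A] E) (D : E →ₗ.[A] E) : Prop :=
  ∀ z : ℂ, z.im ≠ 0 → ∃ (R : ℕ → adjointable A E) (R₀ : adjointable A E),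
    (∀ n, IsResolventAt (T n) z (R n)) ∧ IsResolventAt D z R₀ ∧ Tendsto R atTop (𝓝 R₀)

end Module

end CantorBloch

end

/-! Fix a real `t` outside the spectrum. The resolvent `R = (D - t)⁻¹` is self-adjoint, `A`-compact
and of dense range. Conversely, every self-adjoint `A`-compact `u` of dense range is injective, and
`t + u⁻¹` is then a self-adjoint `A`-elliptic operator whose spectrum is the image of the nonzero
spectrum of `u` under `r ↦ t + r⁻¹`. So it suffices to approximate `R` in norm by such `u` whose
spectrum has empty interior and no isolated points except possibly `0`; the point `0` is sent to
infinity.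

Such `u` exist by Baire's theorem in the self-adjoint part of `K = 𝓚_A(E)`. Three countable families
of sets contain open dense subsets. (1) The spectrum omits a point of a given interval: elements of
finite spectrum are dense. (2) The spectrum does not meet a given interval away from `0` in exactly
one point: the faithful state gives the spectral part in the interval a definite mass, and minimal
projections of tiny mass cannot carry it alone. (3) `r r*` is within `ε` of `u K`: the range
projection of a finite-spectrum element misses part of `r`, and a small positive perturbation
restores it. Condition (3) for all `ε` makes the range of `u` dense when that of `r` is. -/

noncomputable section

namespace CantorBloch

/-! ### Functional calculus and semicontinuity of the quasispectrum -/

section Generic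

variable {K : Type*} [NonUnitalCStarAlgebra K]

/-- A continuous function which is positive on `(a, b)` and zero elsewhere. -/
def bump (a b s : ℝ) : ℝ := max 0 (min (s - a) (b - s))

theorem continuous_bump (a b : ℝ) : Continuous (bump a b) := by
  unfold bump; fun_prop

theorem bump_nonneg (a b s : ℝ) : 0 ≤ bump a b s := le_max_left _ _

theorem bump_ne_zero_iff {a b s : ℝ} : bump a b s ≠ 0 ↔ s ∈ Set.Ioo a b := by
  rw [← (bump_nonneg a b s).lt_iff_ne', bump, lt_max_iff, lt_min_iff, Set.mem_Ioo]
  simp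

theorem bump_le {a b : ℝ} (h : a < b) (s : ℝ) : bump a b s ≤ b - a := by
  unfold bump
  rcases le_total s a with h' | h'
  · exact max_le (by linarith) ((min_le_left _ _).trans (by linarith))
  · exact max_le (by linarith) ((min_le_right _ _).trans (by linarith))

theorem bump_zero {a b : ℝ} (h0 : (0 : ℝ) ∉ Set.Ioo a b) : bump a b 0 = 0 := by
  by_contra h
  exact h0 (bump_ne_zero_iff.mp h)

/-- This turns a spectral condition into one on a norm-continuous function of `u`. The interval must
avoid `0` because the non-unital calculus needs functions vanishing there. -/
theorem cfcₙ_bump_ne_zero_iff {a b : ℝ} (h0 : (0 : ℝ) ∉ Set.Ioo a b) {u : K}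
    (hu : IsSelfAdjoint u) :
    cfcₙ (bump a b) u ≠ 0 ↔ (quasispectrum ℝ u ∩ Set.Ioo a b).Nonempty := by
  rw [not_iff_comm, Set.not_nonempty_iff_eq_empty, ← cfcₙ_const_zero ℝ u,
    cfcₙ_eq_cfcₙ_iff_eqOn hu (continuous_bump a b).continuousOn (bump_zero h0)
      continuousOn_const rfl, Set.eq_empty_iff_forall_notMem]
  refine forall_congr' fun s => ?_
  rw [Set.mem_inter_iff, not_and]
  refine imp_congr_right fun _ => ?_
  rw [← bump_ne_zero_iff, not_not]

theorem continuous_cfcₙ_bump {a b : ℝ} (h0 : (0 : ℝ) ∉ Set.Ioo a b) :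
    Continuous fun u : selfAdjoint K => cfcₙ (bump a b) (u : K) :=
  Continuous.cfcₙ_of_mem_nhdsSet (s := Set.univ) (bump a b) univ_mem continuous_subtype_val
    (fun u => u.2) (continuous_bump a b).continuousOn (bump_zero h0)

theorem isOpen_setOf_quasispectrum_inter_Ioo_nonempty {a b : ℝ} (h0 : (0 : ℝ) ∉ Set.Ioo a b) :
    IsOpen {u : selfAdjoint K | (quasispectrum ℝ (u : K) ∩ Set.Ioo a b).Nonempty} := by
  simp_rw [← fun u : selfAdjoint K => cfcₙ_bump_ne_zero_iff h0 u.2]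
  exact isOpen_ne_fun (continuous_cfcₙ_bump h0) continuous_const

theorem isOpen_setOf_notMem_quasispectrum (t : ℝ) :
    IsOpen {u : K | t ∉ quasispectrum ℝ u} := by
  rw [isOpen_iff_eventually]
  intro u hu
  have h := (upperHemicontinuous_quasispectrum ℝ K).upperHemicontinuousAt u {t}ᶜ
    (isOpen_compl_singleton.mem_nhdsSet.mpr fun s hs hst => hu (hst ▸ hs))
  filter_upwards [h] with v hv hvt
  exact subset_of_mem_nhdsSet hv hvt rfl

theorem completeSpace_selfAdjoint : CompleteSpace (selfAdjoint K) :=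
  (isClosed_eq continuous_star continuous_id :
    IsClosed {u : K | star u = u}).completeSpace_coe

theorem finite_quasispectrum_real {y : K} (h : (quasispectrum ℂ y).Finite) :
    (quasispectrum ℝ y).Finite := by
  rw [← quasispectrum.preimage_algebraMap ℂ]
  exact h.preimage (algebraMap ℝ ℂ).injective.injOn

/-- Faithfulness applies because the bump is the square of its square root, so its calculus has the
form `star c * c`. -/
theorem eq_zero_of_apply_cfcₙ_bump {Φ : K →L[ℂ] ℂ} (hΦ : IsFaithfulState Φ) {a b : ℝ}
    (h0 : (0 : ℝ) ∉ Set.Ioo a b) {u : K} (h : Φ (cfcₙ (bump a b) u) = 0) :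
    cfcₙ (bump a b) u = 0 := by
  have hc : ContinuousOn (fun s => √(bump a b s)) (quasispectrum ℝ u) :=
    (Real.continuous_sqrt.comp (continuous_bump a b)).continuousOn
  have hz : √(bump a b 0) = 0 := by rw [bump_zero h0, Real.sqrt_zero]
  have key : cfcₙ (bump a b) u =
      star (cfcₙ (fun s => √(bump a b s)) u) * cfcₙ (fun s => √(bump a b s)) u := by
    rw [(IsSelfAdjoint.cfcₙ (f := fun s => √(bump a b s)) (a := u)).star_eq,
      ← cfcₙ_mul _ _ u hc hz hc hz]
    exact cfcₙ_congr fun s _ => (Real.mul_self_sqrt (bump_nonneg a b s)).symm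
  rw [key] at h ⊢
  rw [hΦ.faithful _ h, mul_zero]

/-- The spectral projection at a point `t ≠ 0`, if the quasispectrum is finite. -/
theorem isSpectralProjectionAt_cfcₙ {y : K} (hy : IsSelfAdjoint y)
    (hfin : (quasispectrum ℝ y).Finite) {t : ℝ} (ht : t ≠ 0) :
    IsSpectralProjectionAt y t (cfcₙ (Pi.single t 1 : ℝ → ℝ) y) := by
  set χ : ℝ → ℝ := Pi.single t 1 with hχ
  have hc (f : ℝ → ℝ) : ContinuousOn f (quasispectrum ℝ y) := hfin.continuousOn f
  have h0 : χ 0 = 0 := Pi.single_eq_of_ne ht.symm 1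
  have h1 : χ t = 1 := Pi.single_eq_same t 1
  have h2 (s : ℝ) (hs : s ≠ t) : χ s = 0 := Pi.single_eq_of_ne hs 1
  have hsm (z : K) : (t : ℂ) • z = t • z := Complex.coe_smul t z
  refine ⟨⟨?_, IsSelfAdjoint.cfcₙ⟩, fun z => ⟨fun hz => ?_, fun hz => ?_⟩⟩
  · rw [IsIdempotentElem, ← cfcₙ_mul χ χ y (hc _) h0 (hc _) h0]
    refine cfcₙ_congr fun s _ => ?_
    rcases eq_or_ne s t with rfl | hs
    · simp [h1]
    · simp [h2 s hs]
  · -- the function `k` vanishes at `t`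
    set k : ℝ → ℝ := fun s => t * (s / (s - t)) with hk
    have hk0 : k 0 = 0 := by simp [hk]
    -- On the spectrum, `s - t χ(s) = t⁻¹ k(s) (s - t)`, also at `s = t` since division by zero
    -- gives `k(t) = 0`. Hence `y z = t z` forces `(y - t χ(y)) z = 0`.
    have e : y - t • cfcₙ χ y = t⁻¹ • (cfcₙ k y * y - t • cfcₙ k y) := by
      rw [← cfcₙ_const_mul t k y (hc _) hk0, ← cfcₙ_const_mul t χ y (hc _) h0]
      have e1 : cfcₙ k y * y = cfcₙ (fun s => k s * s) y := by
        rw [cfcₙ_mul k (fun s => s) y (hc _) hk0 (hc _) rfl, cfcₙ_id' ℝ y]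
      have e2 : y - cfcₙ (fun s => t * χ s) y = cfcₙ (fun s => s - t * χ s) y := by
        rw [cfcₙ_sub (fun s => s) _ y (hc _) rfl (hc _) (by simp [h0]), cfcₙ_id' ℝ y]
      rw [e1, e2, ← cfcₙ_sub _ _ y (hc _) (by simp) (hc _) (by simp [hk0]),
        ← cfcₙ_const_mul _ _ y (hc _) (by simp [hk0])]
      refine cfcₙ_congr fun s _ => ?_
      rcases eq_or_ne s t with rfl | hs
      · simp [h1, hk]
      · have : s - t ≠ 0 := sub_ne_zero.mpr hs
        simp only [h2 s hs, hk]
        field_simp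
        ring
    have e' := congrArg (· * z) e
    simp only [sub_mul, smul_mul_assoc, mul_assoc, hz, hsm, mul_smul_comm, sub_self,
      smul_zero] at e'
    exact (smul_right_injective K ht (sub_eq_zero.mp e')).symm
  · have e : y * cfcₙ χ y = t • cfcₙ χ y := by
      rw [← cfcₙ_const_mul t χ y (hc _) h0]
      nth_rw 1 [← cfcₙ_id' ℝ y]
      rw [← cfcₙ_mul (fun s => s) χ y (hc _) rfl (hc _) h0]
      refine cfcₙ_congr fun s _ => ?_
      rcases eq_or_ne s t with rfl | hs
      · simp
      · simp [h2 s hs]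
    rw [← hz, ← mul_assoc, e, smul_mul_assoc, hsm]

/-- `a` is a limit of elements `a a* c`. -/
theorem exists_norm_sub_mul_star_mul_lt (a : K) {ε : ℝ} (hε : 0 < ε) :
    ∃ c : K, ‖a - a * star a * c‖ < ε := by
  set b := a * star a with hb
  have hbs : IsSelfAdjoint b := IsSelfAdjoint.mul_star_self a
  set η : ℝ := ε ^ 2 with hη
  have hη0 : 0 < η := by positivity
  -- A regularised inverse: `1 - s g(s) = η² / (s² + η²)`. The squares in the denominator make
  -- positivity of `b` unnecessary. The squared error is at most `η / 2`, which is below `ε²` as `η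
  -- = ε²`.
  set g : ℝ → ℝ := fun s => s / (s ^ 2 + η ^ 2) with hg
  have hpos (s : ℝ) : 0 < s ^ 2 + η ^ 2 := by positivity
  have hgc : Continuous g := by
    rw [hg]; exact continuous_id.div (by fun_prop) fun s => (hpos s).ne'
  have hg0 : g 0 = 0 := by simp [hg]
  set f : ℝ → ℝ := fun s => s * g s with hf
  have hfc : Continuous f := continuous_id.mul hgc
  have hf0 : f 0 = 0 := by simp [hf]
  refine ⟨cfcₙ g b * a, ?_⟩
  have e1 : b * (cfcₙ g b * a) = cfcₙ f b * a := by
    rw [← mul_assoc, hf, cfcₙ_mul (fun s => s) g b continuousOn_id rfl hgc.continuousOn hg0,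
      cfcₙ_id' ℝ b]
  have e2 : (a - cfcₙ f b * a) * star (a - cfcₙ f b * a) =
      cfcₙ (fun s => s - f s * s - s * f s + f s * s * f s) b := by
    have hs : star (cfcₙ f b) = cfcₙ f b := (IsSelfAdjoint.cfcₙ (f := f) (a := b)).star_eq
    have c1 : Continuous fun s => f s * s := by fun_prop
    have c2 : Continuous fun s => s * f s := by fun_prop
    have c3 : Continuous fun s => f s * s * f s := by fun_prop
    have c4 : Continuous fun s => s - f s * s := by fun_prop
    have c5 : Continuous fun s => s - f s * s - s * f s := by fun_prop
    rw [cfcₙ_add _ _ b c5.continuousOn (by simp) c3.continuousOn (by simp),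
      cfcₙ_sub _ _ b c4.continuousOn (by simp) c2.continuousOn (by simp),
      cfcₙ_sub (fun s => s) _ b continuousOn_id rfl c1.continuousOn (by simp),
      cfcₙ_mul (fun s => f s * s) f b c1.continuousOn (by simp) hfc.continuousOn hf0,
      cfcₙ_mul f (fun s => s) b hfc.continuousOn hf0 continuousOn_id rfl,
      cfcₙ_mul (fun s => s) f b continuousOn_id rfl hfc.continuousOn hf0, cfcₙ_id' ℝ b, star_sub, star_mul, hs,
      sub_mul, mul_sub, mul_sub, hb]
    noncomm_ring
  have e3 : ‖a - cfcₙ f b * a‖ * ‖a - cfcₙ f b * a‖ ≤ η / 2 := by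
    rw [← CStarRing.norm_self_mul_star, e2]
    refine norm_cfcₙ_le fun s _ => ?_
    have : s - f s * s - s * f s + f s * s * f s = s * (η ^ 2 / (s ^ 2 + η ^ 2)) ^ 2 := by
      simp only [hf, hg]
      have := (hpos s).ne'
      field_simp
      ring
    rw [this, Real.norm_eq_abs, abs_mul, abs_of_nonneg (sq_nonneg (η ^ 2 / (s ^ 2 + η ^ 2)))]
    have h1 : η ^ 2 / (s ^ 2 + η ^ 2) ≤ 1 := (div_le_one (hpos s)).mpr (by nlinarith [sq_nonneg s])
    have h2 : 0 ≤ η ^ 2 / (s ^ 2 + η ^ 2) := by positivity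
    calc |s| * (η ^ 2 / (s ^ 2 + η ^ 2)) ^ 2 ≤ |s| * (η ^ 2 / (s ^ 2 + η ^ 2)) := by
          gcongr; nlinarith
      _ ≤ η / 2 := by
          rw [← mul_div_assoc, div_le_div_iff₀ (hpos s) two_pos]
          nlinarith [sq_nonneg (|s| - η), sq_abs s]
  rw [e1]
  refine lt_of_pow_lt_pow_left₀ 2 hε.le ?_
  rw [sq]
  linarith

/-! ### The open dense sets for Baire's theorem -/

theorem dense_setOf_exists_notMem_quasispectrum
    (happrox : ∀ x : K, IsSelfAdjoint x → ∀ ε : ℝ, 0 < ε →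
      ∃ y : K, IsSelfAdjoint y ∧ ‖x - y‖ < ε ∧ (quasispectrum ℂ y).Finite)
    {a b : ℝ} (hab : a < b) :
    Dense {u : selfAdjoint K | ∃ t ∈ Set.Ioo a b, t ∉ quasispectrum ℝ (u : K)} := by
  rw [Metric.dense_iff]
  intro x ε hε
  obtain ⟨y, hy, hxy, hfin⟩ := happrox x x.2 ε hε
  refine ⟨⟨y, hy⟩, ?_, ?_⟩
  · rw [Metric.mem_ball, dist_comm, dist_eq_norm]; exact hxy
  · exact (Set.Ioo_infinite hab).exists_notMem_finite (finite_quasispectrum_real hfin)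

theorem isOpen_setOf_exists_notMem_quasispectrum (a b : ℝ) :
    IsOpen {u : selfAdjoint K | ∃ t ∈ Set.Ioo a b, t ∉ quasispectrum ℝ (u : K)} := by
  have : {u : selfAdjoint K | ∃ t ∈ Set.Ioo a b, t ∉ quasispectrum ℝ (u : K)} =
      ⋃ t ∈ Set.Ioo a b, {u : selfAdjoint K | t ∉ quasispectrum ℝ (u : K)} := by
    ext u; simp
  rw [this]
  exact isOpen_biUnion fun t _ =>
    (isOpen_setOf_notMem_quasispectrum t).preimage continuous_subtype_val

/-- This is where the infinitesimal state enters. A single spectral point in `(a, b)` would make the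
bump of `y` a multiple of one minimal projection, whose mass is too small; and having two spectral
points there is an open condition. -/
theorem dense_interior_setOf_quasispectrum_inter_Ioo_ne_singleton (hK : HasRRI0 K)
    {a b : ℝ} (hab : a < b) (h0 : (0 : ℝ) ∉ Set.Ioo a b) :
    Dense (interior
      {u : selfAdjoint K | ∀ t, quasispectrum ℝ (u : K) ∩ Set.Ioo a b ≠ {t}}) := by
  obtain ⟨Φ, hΦ, happrox⟩ := hK
  rw [Metric.dense_iff]
  intro x ε hε
  -- If no element of the ball has spectrum in the interval, the whole ball lies in the set.
  by_cases hex : ∃ x' ∈ Metric.ball x ε, (quasispectrum ℝ (x' : K) ∩ Set.Ioo a b).Nonempty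
  swap
  · push Not at hex
    refine ⟨x, Metric.mem_ball_self hε, ?_⟩
    refine mem_interior.mpr ⟨Metric.ball x ε, fun u hu t ht => ?_, Metric.isOpen_ball,
      Metric.mem_ball_self hε⟩
    exact Set.singleton_ne_empty t (ht.symm.trans (hex u hu))
  obtain ⟨x', hx', hne⟩ := hex
  have hΦx : Φ (cfcₙ (bump a b) (x' : K)) ≠ 0 := fun h =>
    (cfcₙ_bump_ne_zero_iff h0 x'.2).mpr hne (eq_zero_of_apply_cfcₙ_bump hΦ h0 h)
  set m := ‖Φ (cfcₙ (bump a b) (x' : K))‖ with hm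
  have hm0 : 0 < m := norm_pos_iff.mpr hΦx
  have hcont : Continuous fun u : selfAdjoint K => ‖Φ (cfcₙ (bump a b) (u : K))‖ :=
    (Φ.continuous.comp (continuous_cfcₙ_bump h0)).norm
  have hnhds : Metric.ball x ε ∩ {u : selfAdjoint K | m / 2 < ‖Φ (cfcₙ (bump a b) (u : K))‖}
      ∈ 𝓝 x' :=
    inter_mem (Metric.isOpen_ball.mem_nhds hx')
      ((isOpen_lt continuous_const hcont).mem_nhds (half_lt_self hm0))
  obtain ⟨δ, hδ, hball⟩ := Metric.mem_nhds_iff.mp hnhds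
  have hba : 0 < b - a := sub_pos.mpr hab
  -- The bump is at most `b - a`, so a lone projection would contribute mass at most `m / 2`, while
  -- `δ` keeps the mass above `m / 2`.
  obtain ⟨y, hy, hxy, hfin, hproj⟩ := happrox x' x'.2 (min δ (m / 2 / (b - a))) (by positivity)
  obtain ⟨hyx, hyΦ⟩ := @hball ⟨y, hy⟩ (by
    rw [Metric.mem_ball, dist_comm, dist_eq_norm]; exact hxy.trans_le (min_le_left _ _))
  replace hyΦ : m / 2 < ‖Φ (cfcₙ (bump a b) y)‖ := hyΦ
  have hyne : (quasispectrum ℝ y ∩ Set.Ioo a b).Nonempty := by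
    rw [← cfcₙ_bump_ne_zero_iff h0 hy]
    intro h
    rw [h, map_zero, norm_zero] at hyΦ
    linarith
  have hfinR := finite_quasispectrum_real hfin
  have hnotsing (t : ℝ) : quasispectrum ℝ y ∩ Set.Ioo a b ≠ {t} := by
    intro ht
    obtain ⟨ht1, ht2⟩ : t ∈ quasispectrum ℝ y ∩ Set.Ioo a b := ht ▸ rfl
    have ht0 : t ≠ 0 := fun h => h0 (h ▸ ht2)
    have hz : (Pi.single t 1 : ℝ → ℝ) 0 = 0 := Pi.single_eq_of_ne ht0.symm 1
    set p := cfcₙ (Pi.single t 1 : ℝ → ℝ) y with hp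
    have hfp : cfcₙ (bump a b) y = bump a b t • p := by
      rw [hp, ← cfcₙ_const_mul _ (Pi.single t 1 : ℝ → ℝ) y (hfinR.continuousOn _) hz]
      refine cfcₙ_congr fun s hs => ?_
      rcases eq_or_ne s t with rfl | hst
      · rw [Pi.single_eq_same, mul_one]
      · rw [Pi.single_eq_of_ne hst, mul_zero]
        by_contra h
        exact hst (ht ▸ ⟨hs, bump_ne_zero_iff.mp h⟩ : s ∈ ({t} : Set ℝ))
    have hp0 : p ≠ 0 := by
      intro h
      rw [h, smul_zero] at hfp
      rw [hfp, map_zero, norm_zero] at hyΦ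
      linarith
    have hlt := hproj t p hp0 (isSpectralProjectionAt_cfcₙ hy hfinR ht0)
    rw [hfp, ← Complex.coe_smul, map_smul, norm_smul, Complex.norm_real, Real.norm_eq_abs,
      abs_of_nonneg (bump_nonneg a b t)] at hyΦ
    have h1 : bump a b t * ‖Φ p‖ ≤ (b - a) * (m / 2 / (b - a)) := by
      gcongr
      · exact bump_le hab t
      · exact (hlt.trans_le (min_le_right _ _)).le
    rw [mul_div_cancel₀ _ hba.ne'] at h1
    linarith
  obtain ⟨t, ht⟩ := hyne
  obtain ⟨t', ht', htt'⟩ : ∃ t' ∈ quasispectrum ℝ y ∩ Set.Ioo a b, t' ≠ t := by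
    by_contra! h
    exact hnotsing t (Set.eq_singleton_iff_unique_mem.mpr ⟨ht, h⟩)
  have main (t₁ t₂ : ℝ) (h₁ : t₁ ∈ quasispectrum ℝ y ∩ Set.Ioo a b)
      (h₂ : t₂ ∈ quasispectrum ℝ y ∩ Set.Ioo a b) (h12 : t₁ < t₂) :
      (⟨y, hy⟩ : selfAdjoint K) ∈ interior
        {u : selfAdjoint K | ∀ t, quasispectrum ℝ (u : K) ∩ Set.Ioo a b ≠ {t}} := by
    -- Meeting both `(a, c)` and `(c, b)` is an open condition that rules out a singleton.
    obtain ⟨c, hc1, hc2⟩ := exists_between h12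
    have hl : (0 : ℝ) ∉ Set.Ioo a c := fun h => h0 ⟨h.1, h.2.trans (hc2.trans h₂.2.2)⟩
    have hr : (0 : ℝ) ∉ Set.Ioo c b := fun h => h0 ⟨(h₁.2.1.trans hc1).trans h.1, h.2⟩
    refine mem_interior.mpr ⟨_, fun u hu s hs => ?_,
      (isOpen_setOf_quasispectrum_inter_Ioo_nonempty (K := K) hl).inter
        (isOpen_setOf_quasispectrum_inter_Ioo_nonempty hr),
      ⟨t₁, h₁.1, h₁.2.1, hc1⟩, ⟨t₂, h₂.1, hc2, h₂.2.2⟩⟩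
    obtain ⟨⟨s₁, hs₁, hs₁'⟩, ⟨s₂, hs₂, hs₂'⟩⟩ := hu
    have e₁ : s₁ = s := (hs ▸ ⟨hs₁, hs₁'.1, hs₁'.2.trans (hc2.trans h₂.2.2)⟩ : s₁ ∈ ({s} : Set ℝ))
    have e₂ : s₂ = s := (hs ▸ ⟨hs₂, (h₁.2.1.trans hc1).trans hs₂'.1, hs₂'.2⟩ : s₂ ∈ ({s} : Set ℝ))
    linarith [hs₁'.2, hs₂'.1]
  refine ⟨⟨y, hy⟩, hyx, ?_⟩
  rcases lt_or_gt_of_ne htt' with h | h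
  · exact main t' t ht' ht h
  · exact main t t' ht ht' h

theorem isOpen_setOf_exists_norm_sub_mul_lt (h : K) (ε : ℝ) :
    IsOpen {u : selfAdjoint K | ∃ c : K, ‖h - u * c‖ < ε} := by
  have : {u : selfAdjoint K | ∃ c : K, ‖h - u * c‖ < ε} =
      ⋃ c : K, {u : selfAdjoint K | ‖h - u * c‖ < ε} := by
    ext u; simp
  rw [this]
  exact isOpen_iUnion fun c => isOpen_lt (by fun_prop) continuous_const

/-- Approximate by `y` of finite spectrum with range projection `p`, and perturb to `y + δ a a*`
with `a = (1 - p) r`. The two summands act on orthogonal parts: `y` reaches `p r r*` exactly, and `a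
a*` reaches `a r* = (1 - p) r r*` approximately. -/
theorem dense_setOf_exists_norm_sub_mul_lt
    (happrox : ∀ x : K, IsSelfAdjoint x → ∀ ε : ℝ, 0 < ε →
      ∃ y : K, IsSelfAdjoint y ∧ ‖x - y‖ < ε ∧ (quasispectrum ℂ y).Finite)
    (r : K) {ε : ℝ} (hε : 0 < ε) :
    Dense {u : selfAdjoint K | ∃ c : K, ‖r * star r - u * c‖ < ε} := by
  rw [Metric.dense_iff]
  intro x ε' hε'
  obtain ⟨y, hy, hxy, hfin⟩ := happrox x x.2 (ε' / 2) (by positivity)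
  have hc (f : ℝ → ℝ) : ContinuousOn f (quasispectrum ℝ y) :=
    (finite_quasispectrum_real hfin).continuousOn f
  -- As `0⁻¹ = 0`, `v` inverts `y` on its range and `p = y v` is the range projection; continuity is
  -- automatic on a finite spectrum.
  set v := cfcₙ (fun s : ℝ => s⁻¹) y with hv
  set p := cfcₙ (fun s : ℝ => s * s⁻¹) y with hp
  have hps : star p = p := (IsSelfAdjoint.cfcₙ (f := fun s : ℝ => s * s⁻¹) (a := y)).star_eq
  have hyv : y * v = p := by
    rw [hp, cfcₙ_mul (fun s => s) (fun s => s⁻¹) y (hc _) rfl (hc _) inv_zero, cfcₙ_id' ℝ y]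
  have hyp : y * p = y := by
    rw [hp]
    nth_rw 1 [← cfcₙ_id' ℝ y]
    rw [← cfcₙ_mul _ _ y (hc _) rfl (hc _) (by simp)]
    nth_rw 2 [← cfcₙ_id' ℝ y]
    exact cfcₙ_congr fun s _ => by
      rcases eq_or_ne s 0 with h | h
      · simp [h]
      · simp [h]
  have hpv : p * v = v := by
    rw [hp, hv, ← cfcₙ_mul _ _ y (hc _) (by simp) (hc _) inv_zero]
    exact cfcₙ_congr fun s _ => by
      rcases eq_or_ne s 0 with h | h
      · simp [h]
      · simp [h]
  have hvp : v * p = v := by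
    rw [hp, hv, ← cfcₙ_mul _ _ y (hc _) inv_zero (hc _) (by simp)]
    exact cfcₙ_congr fun s _ => by
      rcases eq_or_ne s 0 with h | h
      · simp [h]
      · simp [h]
  have hpp : p * p = p := by
    have h : y * v * p = y * v := by rw [mul_assoc, hvp]
    rwa [hyv] at h
  set a := r - p * r with ha
  set δ : ℝ := ε' / 2 / (‖a * star a‖ + 1) with hδ
  have hδ0 : 0 < δ := by positivity
  have hδa : ‖δ • (a * star a)‖ < ε' / 2 := by
    rw [norm_smul, Real.norm_eq_abs, abs_of_pos hδ0, hδ, div_mul_eq_mul_div,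
      div_lt_iff₀ (by positivity)]
    gcongr
    linarith
  obtain ⟨c, hc'⟩ := exists_norm_sub_mul_star_mul_lt a (ε := ε / (‖r‖ + 1)) (by positivity)
  have hav : star a * v = 0 := by
    rw [ha, star_sub, star_mul, hps, sub_mul, mul_assoc, hpv, sub_self]
  have hap : star a * p = 0 := by
    rw [ha, star_sub, star_mul, hps, sub_mul, mul_assoc, hpp, sub_self]
  refine ⟨⟨y + δ • (a * star a), hy.add ((IsSelfAdjoint.all δ).smul
    (IsSelfAdjoint.mul_star_self a))⟩, ?_, ?_⟩
  · rw [Metric.mem_ball, dist_comm, dist_eq_norm]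
    calc ‖(x : K) - (y + δ • (a * star a))‖ = ‖((x : K) - y) - δ • (a * star a)‖ := by
          rw [sub_add_eq_sub_sub]
      _ ≤ ‖(x : K) - y‖ + ‖δ • (a * star a)‖ := norm_sub_le _ _
      _ < ε' := by linarith
  -- The factor `1 - p` is annihilated by `y` and `v` by `a*`, so no cross terms survive; the error
  -- is `(a - a a* c) r*`.
  · refine ⟨v * (r * star r) + δ⁻¹ • (c * star r - p * (c * star r)), ?_⟩
    have e : (y + δ • (a * star a)) * (v * (r * star r) + δ⁻¹ • (c * star r - p * (c * star r)))
        = p * (r * star r) + a * star a * c * star r := by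
      have e1 : y * (v * (r * star r)) = p * (r * star r) := by rw [← mul_assoc, hyv]
      have e2 : y * (c * star r - p * (c * star r)) = 0 := by
        rw [mul_sub, ← mul_assoc y p, hyp, sub_self]
      have e3 : a * star a * (v * (r * star r)) = 0 := by
        rw [mul_assoc, ← mul_assoc (star a), hav, zero_mul, mul_zero]
      have e4 : a * star a * (c * star r - p * (c * star r)) = a * star a * c * star r := by
        rw [mul_sub, mul_assoc a (star a) (p * _), ← mul_assoc (star a) p, hap, zero_mul, mul_zero,
          sub_zero, mul_assoc (a * star a)]
      rw [add_mul, mul_add, mul_add, e1, mul_smul_comm, e2, smul_mul_assoc, e3, smul_mul_assoc,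
        mul_smul_comm, e4, smul_inv_smul₀ hδ0.ne', smul_zero, smul_zero, add_zero, zero_add]
    have e' : r * star r - (p * (r * star r) + a * star a * c * star r) =
        (a - a * star a * c) * star r := by
      rw [sub_mul a, ← sub_sub, ← mul_assoc p, ← sub_mul]
    change ‖r * star r - (y + δ • (a * star a)) * _‖ < ε
    rw [e, e']
    calc ‖(a - a * star a * c) * star r‖ ≤ ‖a - a * star a * c‖ * ‖r‖ := by
          rw [← norm_star r]; exact norm_mul_le _ _
      _ ≤ ‖a - a * star a * c‖ * (‖r‖ + 1) := by gcongr; linarith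
      _ < ε := (lt_div_iff₀ (by positivity)).mp hc'

/-- In an algebra of real rank zero with infinitesimal state, every self-adjoint element is a limit
of self-adjoint elements `u` with Cantor spectrum and such that `r r*` lies in the closure
of `u K`. -/
theorem exists_cantor_approximation (hK : HasRRI0 K) (r : K) {x : K} (hx : IsSelfAdjoint x)
    {ε : ℝ} (hε : 0 < ε) :
    ∃ u : K, IsSelfAdjoint u ∧ ‖u - x‖ < ε ∧
      (∀ a b : ℝ, a < b → ∃ t ∈ Set.Ioo a b, t ∉ quasispectrum ℝ u) ∧
      (∀ a b : ℝ, (0 : ℝ) ∉ Set.Ioo a b → ∀ t, quasispectrum ℝ u ∩ Set.Ioo a b ≠ {t}) ∧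
      ∀ ε > 0, ∃ c : K, ‖r * star r - u * c‖ < ε := by
  have happrox : ∀ x : K, IsSelfAdjoint x → ∀ ε : ℝ, 0 < ε →
      ∃ y : K, IsSelfAdjoint y ∧ ‖x - y‖ < ε ∧ (quasispectrum ℂ y).Finite := by
    obtain ⟨Φ, -, h⟩ := hK
    intro x hx ε hε
    obtain ⟨y, h1, h2, h3, -⟩ := h x hx ε hε
    exact ⟨y, h1, h2, h3⟩
  have : CompleteSpace (selfAdjoint K) := completeSpace_selfAdjoint
  -- Rational endpoints keep the families countable. Any interval contains a rational one, which may
  -- be chosen around a prescribed point.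
  have d1 := dense_iInter_of_isOpen
    (f := fun q : {q : ℚ × ℚ // (q.1 : ℝ) < q.2} => {u : selfAdjoint K |
      ∃ t ∈ Set.Ioo (q.1.1 : ℝ) q.1.2, t ∉ quasispectrum ℝ (u : K)})
    (fun q => isOpen_setOf_exists_notMem_quasispectrum _ _)
    (fun q => dense_setOf_exists_notMem_quasispectrum happrox q.2)
  have o2 (q : {q : ℚ × ℚ // (q.1 : ℝ) < q.2 ∧ (0 : ℝ) ∉ Set.Ioo (q.1 : ℝ) q.2}) :=
    dense_interior_setOf_quasispectrum_inter_Ioo_ne_singleton hK q.2.1 q.2.2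
  have o3 (n : ℕ) := dense_setOf_exists_norm_sub_mul_lt happrox r
    (ε := 1 / ((n : ℝ) + 1)) (by positivity)
  have g1 := IsGδ.iInter_of_isOpen
    (f := fun q : {q : ℚ × ℚ // (q.1 : ℝ) < q.2} => {u : selfAdjoint K |
      ∃ t ∈ Set.Ioo (q.1.1 : ℝ) q.1.2, t ∉ quasispectrum ℝ (u : K)})
    (fun q => isOpen_setOf_exists_notMem_quasispectrum _ _)
  have d2 := dense_iInter_of_isOpen (fun q => isOpen_interior) o2
  have g2 := IsGδ.iInter_of_isOpen (f := fun q : {q : ℚ × ℚ //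
    (q.1 : ℝ) < q.2 ∧ (0 : ℝ) ∉ Set.Ioo (q.1 : ℝ) q.2} => interior {u : selfAdjoint K |
      ∀ t, quasispectrum ℝ (u : K) ∩ Set.Ioo (q.1.1 : ℝ) q.1.2 ≠ {t}}) (fun q => isOpen_interior)
  have d3 := dense_iInter_of_isOpen (fun n => isOpen_setOf_exists_norm_sub_mul_lt _ _) o3
  have g3 := IsGδ.iInter_of_isOpen (f := fun n : ℕ => {u : selfAdjoint K |
    ∃ c : K, ‖r * star r - u * c‖ < 1 / ((n : ℝ) + 1)})
    (fun n => isOpen_setOf_exists_norm_sub_mul_lt _ _)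
  obtain ⟨u, hux, ⟨h1, h2⟩, h3⟩ := Metric.dense_iff.mp
    (Dense.inter_of_Gδ (g1.inter g2) g3 (Dense.inter_of_Gδ g1 g2 d1 d2) d3) ⟨x, hx⟩ ε hε
  rw [Set.mem_iInter] at h1 h2 h3
  refine ⟨u, u.2, ?_, fun a b hab => ?_, fun a b h0 t ht => ?_, fun ε hε => ?_⟩
  · rw [Metric.mem_ball, dist_eq_norm] at hux; exact hux
  · obtain ⟨q, hq, hq'⟩ := exists_rat_btwn hab
    obtain ⟨q', hqq', hq''⟩ := exists_rat_btwn hq'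
    obtain ⟨t, ht, ht'⟩ := h1 ⟨(q, q'), hqq'⟩
    exact ⟨t, ⟨hq.trans ht.1, ht.2.trans hq''⟩, ht'⟩
  · obtain ⟨ht1, ht2⟩ : t ∈ quasispectrum ℝ (u : K) ∩ Set.Ioo a b := ht ▸ rfl
    obtain ⟨q, hq, hqt⟩ := exists_rat_btwn ht2.1
    obtain ⟨q', htq', hq'⟩ := exists_rat_btwn ht2.2
    have hsub : Set.Ioo (q : ℝ) q' ⊆ Set.Ioo a b := Set.Ioo_subset_Ioo hq.le hq'.le
    refine interior_subset (h2 ⟨(q, q'), hqt.trans htq', fun h => h0 (hsub h)⟩) t ?_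
    exact Set.eq_singleton_iff_unique_mem.mpr ⟨⟨ht1, hqt, htq'⟩,
      fun s hs => (ht ▸ ⟨hs.1, hsub hs.2⟩ : s ∈ ({t} : Set ℝ))⟩
  · obtain ⟨n, hn⟩ := exists_nat_one_div_lt hε
    obtain ⟨c, hc⟩ := h3 n
    exact ⟨c, hc.trans hn⟩

end Generic

theorem inv_notMem_quasispectrum_iff {K : Type*} [NonUnitalCStarAlgebra K] {u : K} {s : ℝ}
    (hs : s ≠ 0) : s⁻¹ ∉ quasispectrum ℝ u ↔
      ∃ y : K, y + -((s : ℂ) • u) + -((s : ℂ) • u) * y = 0 ∧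
        -((s : ℂ) • u) + y + y * -((s : ℂ) • u) = 0 := by
  rw [← isQuasiregular_iff, quasispectrum, Set.mem_ofPred_eq]
  push Not
  have hsu (hr : IsUnit s⁻¹) : hr.unit⁻¹ • u = (s : ℂ) • u := by
    rw [Complex.coe_smul, Units.smul_def, Units.val_inv_eq_inv_val, IsUnit.unit_spec, inv_inv]
  exact ⟨fun ⟨hr, h⟩ => hsu hr ▸ h, fun h => ⟨(inv_ne_zero hs).isUnit, (hsu _).symm ▸ h⟩⟩

/-! ### Unbounded operators encoded by a bounded resolvent -/

section Operators

set_option linter.unusedSectionVars false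

variable {A : Type*} {E : Type*} [CStarAlgebra A] [PartialOrder A] [StarOrderedRing A]
  [NormedAddCommGroup E] [NormedSpace ℂ E] [Module A E] [CStarModule A E]

theorem adjointable_map_smul (T : adjointable A E) (a : A) (x : E) : T.1 (a • x) = a • T.1 x :=
  ext_inner A fun w => by
    have h := (star_spec A T).symm
    rw [← h, CStarModule.inner_op_smul_right, CStarModule.inner_op_smul_right, h]

/-- An adjointable operator as an `A`-linear map. -/
def toModuleHom (T : adjointable A E) : E →ₗ[A] E where
  toFun := T.1
  map_add' := map_add T.1
  map_smul' := adjointable_map_smul T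

theorem IsSelfAdjoint.inner_apply {u : adjointable A E} (hu : IsSelfAdjoint u) (x y : E) :
    inner A (u.1 x) y = inner A x (u.1 y) := by
  have h := star_spec A u
  rw [hu.star_eq] at h
  exact h x y

theorem isSelfAdjoint_of_inner_apply {u : adjointable A E}
    (h : ∀ x y : E, inner A (u.1 x) y = inner A x (u.1 y)) : IsSelfAdjoint u :=
  star_eq_of h

section Resolvent

variable {D : E →ₗ.[A] E} {z₀ : ℂ} {u : adjointable A E}

/-- The factorisation `D - z = (1 - (z - z₀) u) (D - z₀)` on the domain. -/
theorem IsResolventAt.of_isUnit (h : IsResolventAt D z₀ u) {z : ℂ}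
    (hw : IsUnit (1 - (z - z₀) • u)) :
    IsResolventAt D z (u * Ring.inverse (1 - (z - z₀) • u)) := by
  set w := 1 - (z - z₀) • u with hwdef
  have hw1 (v : E) : w.1 ((Ring.inverse w).1 v) = v :=
    congrArg (fun T : adjointable A E => T.1 v) (Ring.mul_inverse_cancel w hw)
  have hw2 (v : E) : (Ring.inverse w).1 (w.1 v) = v :=
    congrArg (fun T : adjointable A E => T.1 v) (Ring.inverse_mul_cancel w hw)
  have hwv (v : E) : w.1 v = v - (z - z₀) • u.1 v := rfl
  refine ⟨fun x => ?_, fun y => ?_⟩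
  · have e : D x - z • (x : E) = w.1 (D x - z₀ • (x : E)) := by
      rw [hwv, h.1, sub_smul]; abel
    change u.1 ((Ring.inverse w).1 _) = _
    rw [e, hw2, h.1]
  · obtain ⟨x, hx1, hx2⟩ := h.2 ((Ring.inverse w).1 y)
    refine ⟨x, hx1, ?_⟩
    rw [← hw1 y, hwv, ← hx1, ← hx2, sub_smul]
    abel

/-- By the resolvent identity, the inverse is `1 + (z - z₀) R`. -/
theorem IsResolventAt.isUnit (h : IsResolventAt D z₀ u) {z : ℂ} {R : adjointable A E}
    (hR : IsResolventAt D z R) : IsUnit (1 - (z - z₀) • u) := by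
  have key (v : E) : R.1 (v - (z - z₀) • u.1 v) = u.1 v := by
    obtain ⟨x, hx1, hx2⟩ := h.2 v
    have := hR.1 x
    rw [← hx1, ← this]
    congr 1
    rw [← hx2, this, sub_smul]
    abel
  have key' (v : E) : u.1 (v + (z - z₀) • R.1 v) = R.1 v := by
    obtain ⟨x, hx1, hx2⟩ := hR.2 v
    have := h.1 x
    rw [← hx1, ← this]
    congr 1
    rw [← hx2, this, sub_smul]
    abel
  refine isUnit_iff_exists.mpr ⟨1 + (z - z₀) • R, ?_, ?_⟩
  · refine Subtype.ext (ContinuousLinearMap.ext fun v => ?_)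
    change (v + (z - z₀) • R.1 v) - (z - z₀) • u.1 (v + (z - z₀) • R.1 v) = v
    rw [key']; abel
  · refine Subtype.ext (ContinuousLinearMap.ext fun v => ?_)
    change (v - (z - z₀) • u.1 v) + (z - z₀) • R.1 (v - (z - z₀) • u.1 v) = v
    rw [key]; abel

theorem IsResolventAt.mem_spec_iff (h : IsResolventAt D z₀ u) {z : ℂ} :
    z ∈ spec D ↔ ¬ IsUnit (1 - (z - z₀) • u) :=
  not_congr ⟨fun ⟨_, hR⟩ => h.isUnit hR, fun hw => ⟨_, h.of_isUnit hw⟩⟩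

theorem IsResolventAt.range_eq (h : IsResolventAt D z₀ u) :
    Set.range u.1 = (D.domain : Set E) := by
  ext x
  constructor
  · rintro ⟨v, rfl⟩
    obtain ⟨x, hx, -⟩ := h.2 v
    exact hx ▸ x.2
  · intro hx
    exact ⟨_, h.1 ⟨x, hx⟩⟩

theorem IsResolventAt.mem_graph_iff (h : IsResolventAt D z₀ u) {y z : E} :
    (y, z) ∈ D.graph ↔ u.1 (z - z₀ • y) = y := by
  rw [LinearPMap.mem_graph_iff]
  constructor
  · rintro ⟨x, rfl, rfl⟩
    exact h.1 x
  · intro hyz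
    obtain ⟨x, hx1, hx2⟩ := h.2 (z - z₀ • y)
    rw [hyz] at hx1
    refine ⟨x, hx1, ?_⟩
    rw [hx1] at hx2
    exact sub_left_injective hx2

theorem IsResolventAt.isSelfAdjoint {t : ℝ} (hD : IsSelfAdjointOp D)
    (h : IsResolventAt D t u) : IsSelfAdjoint u := by
  refine isSelfAdjoint_of_inner_apply fun y y' => ?_
  obtain ⟨x, hx1, hx2⟩ := h.2 y
  obtain ⟨x', hx1', hx2'⟩ := h.2 y'
  have hsymm : inner A (D x) (x' : E) = inner A (x : E) (D x') :=
    (hD.2 x' (D x')).mpr (D.mem_graph x') x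
  rw [← hx1, ← hx1', ← hx2, ← hx2', CStarModule.inner_sub_right, CStarModule.inner_sub_left,
    hsymm, CStarModule.inner_smul_left_complex, CStarModule.inner_smul_right_complex]
  simp

theorem IsResolventAt.isSelfAdjointOp {t : ℝ} (h : IsResolventAt D t u) (hu : IsSelfAdjoint u)
    (hdense : DenseRange u.1) : IsSelfAdjointOp D := by
  refine ⟨h.range_eq ▸ hdense, fun y z => ?_⟩
  have hs : star (t : ℂ) = t := Complex.conj_ofReal t
  have key (v : E) : inner A v (u.1 (z - (t : ℂ) • y)) = inner A (u.1 v) z -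
      inner A ((t : ℂ) • u.1 v) y := by
    rw [← IsSelfAdjoint.inner_apply hu, CStarModule.inner_sub_right,
      CStarModule.inner_smul_right_complex, CStarModule.inner_smul_left_complex, hs]
  rw [h.mem_graph_iff]
  constructor
  · intro hyz
    refine ext_inner A fun v => ?_
    obtain ⟨x, hx1, hx2⟩ := h.2 v
    rw [key, ← hx1, ← hyz x, ← CStarModule.inner_sub_left, hx2]
  · intro hyz x
    have := key (D x - (t : ℂ) • (x : E))
    rw [h.1, hyz, CStarModule.inner_sub_left] at this
    exact sub_left_injective this

/-- The operator with resolvent `u` at `t`. -/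
def ofResolvent (u : adjointable A E) (hu : Function.Injective u.1) (t : ℂ) : E →ₗ.[A] E where
  domain := LinearMap.range (toModuleHom u)
  toFun := ((LinearEquiv.ofInjective (toModuleHom u) hu).symm : _ →ₗ[A] E) +
    (toModuleHom (t • 1 : adjointable A E)).comp (LinearMap.range (toModuleHom u)).subtype

theorem isResolventAt_ofResolvent (hu : Function.Injective u.1) (t : ℂ) :
    IsResolventAt (ofResolvent u hu t) t u := by
  have key (x : LinearMap.range (toModuleHom u)) : ofResolvent u hu t x - t • (x : E) =
      (LinearEquiv.ofInjective (toModuleHom u) hu).symm x := by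
    change ((LinearEquiv.ofInjective (toModuleHom u) hu).symm x + t • (x : E)) - t • (x : E) = _
    abel
  refine ⟨fun x => ?_, fun y => ⟨LinearEquiv.ofInjective (toModuleHom u) hu y, rfl, ?_⟩⟩
  · exact (congrArg u.1 (key x)).trans (congrArg Subtype.val
      ((LinearEquiv.ofInjective (toModuleHom u) hu).apply_symm_apply x))
  · exact (key _).trans (LinearEquiv.symm_apply_apply _ y)

/-- The kernel of a self-adjoint operator is orthogonal to its range. -/
theorem injective_of_isSelfAdjoint_of_denseRange (hu : IsSelfAdjoint u)
    (hdense : DenseRange u.1) : Function.Injective u.1 := by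
  rw [injective_iff_map_eq_zero]
  intro x hx
  refine ext_inner A fun z => ?_
  have hc : Continuous fun z : E => inner A z x :=
    CStarModule.continuous_inner.comp (continuous_id.prodMk continuous_const)
  have : (fun z : E => inner A z x) = fun _ => 0 :=
    hdense.equalizer hc continuous_const (funext fun v => by
      change inner A (u.1 v) x = 0
      rw [IsSelfAdjoint.inner_apply hu, hx, CStarModule.inner_zero_right])
  rw [CStarModule.inner_zero_right]
  exact congrFun this z

end Resolvent

variable [CompleteSpace E]

/-! ### Compactness of the resolvent and ellipticity -/

theorem mul_mem_compactOps (T : adjointable A E) {k : adjointable A E}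
    (hk : k ∈ compactOps A E) : T * k ∈ compactOps A E := by
  refine map_mem_closure (continuous_const.mul continuous_id) hk fun k hk => ?_
  change T * k ∈ Submodule.span ℂ _
  change k ∈ Submodule.span ℂ _ at hk
  induction hk using Submodule.span_induction with
  | mem R hR =>
    obtain ⟨x, y, rfl⟩ := hR
    exact Submodule.subset_span ⟨T.1 x, y, mul_rankOne A T x y⟩
  | zero => rw [mul_zero]; exact Submodule.zero_mem _
  | add R R' _ _ h h' => rw [mul_add]; exact Submodule.add_mem _ h h'
  | smul c R _ h => rw [mul_smul_comm]; exact Submodule.smul_mem _ c h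

theorem mem_compactOps_mul (T : adjointable A E) {k : adjointable A E}
    (hk : k ∈ compactOps A E) : k * T ∈ compactOps A E := by
  have := star_mem (mul_mem_compactOps (star T) (star_mem hk))
  rwa [star_mul, star_star, star_star] at this

theorem mem_compactOps_of_mul_star {a : adjointable A E} (h : a * star a ∈ compactOps A E) :
    a ∈ compactOps A E := by
  refine (inferInstance : IsClosed (compactOps A E : Set (adjointable A E))).closure_subset
    (Metric.mem_closure_iff.mpr fun ε hε => ?_)
  obtain ⟨c, hc⟩ := exists_norm_sub_mul_star_mul_lt a hε
  exact ⟨_, mem_compactOps_mul c h, by rwa [dist_eq_norm]⟩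

theorem isUnit_one_sub_smul {u : adjointable A E} (hu : IsSelfAdjoint u) {z : ℂ}
    (hz : z.im ≠ 0) : IsUnit (1 - z • u) := by
  have hz0 : z ≠ 0 := fun h => hz (h ▸ rfl)
  have h : z⁻¹ ∉ spectrum ℂ u := fun h => by
    have := hu.im_eq_zero_of_mem_spectrum h
    rw [Complex.inv_im, div_eq_zero_iff] at this
    rcases this with h | h
    · exact hz (neg_eq_zero.mp h)
    · exact hz0 (Complex.normSq_eq_zero.mp h)
  rw [spectrum.notMem_iff, Algebra.algebraMap_eq_smul_one] at h
  have e : 1 - z • u = (Units.mk0 z hz0) • (z⁻¹ • (1 : adjointable A E) - u) := by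
    rw [Units.smul_mk0, smul_sub, smul_inv_smul₀ hz0]
  rw [e]
  exact h.smul _

section Elliptic

variable {D : E →ₗ.[A] E} {u : adjointable A E} {t : ℝ}

/-- For the resolvent `u` of `D` at `t`, `D u = 1 + t u`, so this element is `(1 + D²) u²`. It
factors as `(1 + (t + i) u) (1 + (t - i) u)`. -/
theorem isUnit_sq_add_sq (hu : IsSelfAdjoint u) (t : ℝ) :
    IsUnit (u * u + (1 + (t : ℂ) • u) * (1 + (t : ℂ) • u)) := by
  have e : u * u + (1 + (t : ℂ) • u) * (1 + (t : ℂ) • u) =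
      (1 - (-t - Complex.I) • u) * (1 - (-t + Complex.I) • u) := by
    have : Complex.I * Complex.I = -1 := Complex.I_mul_I
    simp only [sub_mul, mul_sub, add_mul, mul_add, one_mul, mul_one, smul_mul_assoc,
      mul_smul_comm, smul_smul, sub_smul, add_smul, neg_smul, smul_sub, smul_add, this, one_smul,
      neg_mul, mul_neg]
    module
  rw [e]
  exact (isUnit_one_sub_smul hu (by simp)).mul (isUnit_one_sub_smul hu (by simp))

/-- The equation `(1 + D²) x = w` in terms of the resolvent of `D`. -/
theorem IsResolventAt.exists_of_graph (h : IsResolventAt D t u) {x : D.domain} {z : E}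
    (hz : (D x, z) ∈ D.graph) : ∃ v : E, (x : E) = (u * u).1 v ∧
      (x : E) + z = (u * u + (1 + (t : ℂ) • u) * (1 + (t : ℂ) • u)).1 v := by
  have h1 := h.mem_graph_iff.mp hz
  have h2 := h.1 x
  -- This is `(D - t)² x`, with `z = D² x`.
  set v := (z - (t : ℂ) • D x) - (t : ℂ) • (D x - (t : ℂ) • (x : E)) with hv
  have huv : u.1 v = D x - (t : ℂ) • (x : E) := by rw [hv, map_sub, map_smul, h1, h2]
  have huuv : u.1 (u.1 v) = x := by rw [huv, h2]
  refine ⟨v, huuv.symm, ?_⟩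
  change _ = u.1 (u.1 v) + ((v + (t : ℂ) • u.1 v) + (t : ℂ) • u.1 (v + (t : ℂ) • u.1 v))
  rw [map_add, map_smul, huuv, huv, hv]
  module

theorem IsResolventAt.exists_graph (h : IsResolventAt D t u) (v : E) :
    ∃ (x : D.domain) (z : E), (D x, z) ∈ D.graph ∧
      (x : E) + z = (u * u + (1 + (t : ℂ) • u) * (1 + (t : ℂ) • u)).1 v := by
  obtain ⟨x₁, h1, h1'⟩ := h.2 v
  obtain ⟨x, h2, h2'⟩ := h.2 (u.1 v)
  refine ⟨x, v + (t : ℂ) • u.1 v + (t : ℂ) • (u.1 v + (t : ℂ) • u.1 (u.1 v)), ?_, ?_⟩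
  · have e : D x = u.1 v + (t : ℂ) • u.1 (u.1 v) := by rw [← h2, ← h2']; abel
    rw [h.mem_graph_iff, e, add_sub_cancel_right, map_add, map_smul]
  · change _ = u.1 (u.1 v) + ((v + (t : ℂ) • u.1 v) + (t : ℂ) • u.1 (v + (t : ℂ) • u.1 v))
    rw [h2, map_add, map_smul]

/-- With `c = (1 + D²) u²` invertible, `(1 + D²)⁻¹ = u² c⁻¹`, which is compact because `u` is. -/
theorem IsResolventAt.isElliptic (h : IsResolventAt D t u) (hu : IsSelfAdjoint u)
    (hdense : DenseRange u.1) (hk : u ∈ compactOps A E) : IsElliptic D := by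
  have hD := h.isSelfAdjointOp hu hdense
  set c := u * u + (1 + (t : ℂ) • u) * (1 + (t : ℂ) • u) with hc
  have hcu : IsUnit c := isUnit_sq_add_sq hu t
  refine ⟨hD.1, hD.1.mono fun y hy => ?_, ?_, u * u * Ring.inverse c,
    mem_compactOps_mul _ (mul_mem hk hk), fun x z hz => ?_⟩
  · exact ⟨D ⟨y, hy⟩, (hD.2 _ _).mpr (D.mem_graph ⟨y, hy⟩)⟩
  · convert dense_univ
    refine Set.eq_univ_of_forall fun w => ?_
    obtain ⟨x, z, hz, e⟩ := h.exists_graph ((Ring.inverse c).1 w)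
    refine ⟨x, z, (hD.2 _ _).mpr hz, e.trans ?_⟩
    exact congrArg (fun T : adjointable A E => T.1 w) (Ring.mul_inverse_cancel c hcu)
  · obtain ⟨v, hv1, hv2⟩ := h.exists_of_graph ((hD.2 _ _).mp hz)
    rw [hv2, hv1]
    change (u * u).1 ((Ring.inverse c).1 (c.1 v)) = _
    exact congrArg (u * u).1
      (congrArg (fun T : adjointable A E => T.1 v) (Ring.inverse_mul_cancel c hcu))

/-- Here `u u* = u² = (1 + D²)⁻¹ c` is compact, and a closed ideal containing `a a*` contains `a`.
-/
theorem IsResolventAt.mem_compactOps (h : IsResolventAt D t u) (hD : IsSelfAdjointOp D)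
    (hDell : IsElliptic D) : u ∈ compactOps A E := by
  have hu := h.isSelfAdjoint hD
  obtain ⟨k, hk, hk'⟩ := hDell.compact_resolvent
  refine mem_compactOps_of_mul_star ?_
  have e : u * star u = k * (u * u + (1 + (t : ℂ) • u) * (1 + (t : ℂ) • u)) := by
    rw [hu.star_eq]
    refine Subtype.ext (ContinuousLinearMap.ext fun v => ?_)
    obtain ⟨x, z, hz, e⟩ := h.exists_graph v
    obtain ⟨v', hv1, hv2⟩ := h.exists_of_graph hz
    have hv : v' = v := by
      have := (isUnit_sq_add_sq hu t)
      set c := u * u + (1 + (t : ℂ) • u) * (1 + (t : ℂ) • u)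
      have hinv (w : E) : (Ring.inverse c).1 (c.1 w) = w :=
        congrArg (fun T : adjointable A E => T.1 w) (Ring.inverse_mul_cancel c this)
      rw [← hinv v', ← hinv v, ← hv2, ← e]
    change (u * u).1 v = k.1 ((u * u + (1 + (t : ℂ) • u) * (1 + (t : ℂ) • u)).1 v)
    rw [← e, hk' x z ((hD.2 _ _).mpr hz), hv1, hv]
  rw [e]
  exact mem_compactOps_mul _ hk

end Elliptic

/-! ### Spectrum of the operator from that of its resolvent -/

section Spectrum

variable {D : E →ₗ.[A] E} {u : compactOps A E} {t : ℝ}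

/-- An inverse in `𝓛_A(E)` differs from `1` by an element of the ideal `𝓚_A(E)`, so invertibility
there and quasi-invertibility in `𝓚_A(E)` agree. -/
theorem isUnit_one_sub_smul_iff {s : ℝ} (hs : s ≠ 0) :
    IsUnit (1 - (s : ℂ) • (u : adjointable A E)) ↔ s⁻¹ ∉ quasispectrum ℝ u := by
  rw [inv_notMem_quasispectrum_iff hs]
  constructor
  · intro hw
    set w := 1 - (s : ℂ) • (u : adjointable A E) with hwdef
    have e1 : (1 - w) * Ring.inverse w = Ring.inverse w - 1 := by
      rw [sub_mul, one_mul, Ring.mul_inverse_cancel w hw]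
    have e2 : Ring.inverse w * (1 - w) = Ring.inverse w - 1 := by
      rw [mul_sub, mul_one, Ring.inverse_mul_cancel w hw]
    have e0 : 1 - w = (s : ℂ) • (u : adjointable A E) := by rw [hwdef]; abel
    have hmem : Ring.inverse w - 1 ∈ compactOps A E := by
      rw [← e1, e0]
      exact mem_compactOps_mul _ (SMulMemClass.smul_mem _ u.2)
    refine ⟨⟨Ring.inverse w - 1, hmem⟩, Subtype.ext ?_, Subtype.ext ?_⟩
    · change (Ring.inverse w - 1) + -((s : ℂ) • (u : adjointable A E)) +
        -((s : ℂ) • (u : adjointable A E)) * (Ring.inverse w - 1) = 0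
      rw [← e0, mul_sub, neg_mul, e1, mul_one]
      abel
    · change -((s : ℂ) • (u : adjointable A E)) + (Ring.inverse w - 1) +
        (Ring.inverse w - 1) * -((s : ℂ) • (u : adjointable A E)) = 0
      rw [← e0, sub_mul, mul_neg, e2, one_mul]
      abel
  · rintro ⟨y, h1, h2⟩
    replace h1 : (y : adjointable A E) + -((s : ℂ) • (u : adjointable A E)) +
      -((s : ℂ) • (u : adjointable A E)) * y = 0 := congrArg Subtype.val h1
    replace h2 : -((s : ℂ) • (u : adjointable A E)) + y +
      y * -((s : ℂ) • (u : adjointable A E)) = 0 := congrArg Subtype.val h2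
    refine isUnit_iff_exists.mpr ⟨1 + y, ?_, ?_⟩
    · rw [← sub_eq_zero, ← h1]
      noncomm_ring
    · rw [← sub_eq_zero, ← h2, add_mul, mul_sub, mul_neg]
      noncomm_ring

theorem IsResolventAt.mem_realSpec_iff (h : IsResolventAt D t (u : adjointable A E)) {s : ℝ} :
    s ∈ realSpec D ↔ s ≠ t ∧ (s - t)⁻¹ ∈ quasispectrum ℝ u := by
  change (s : ℂ) ∈ spec D ↔ _
  rw [h.mem_spec_iff, ← Complex.ofReal_sub]
  rcases eq_or_ne s t with rfl | hs
  · simp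
  · rw [isUnit_one_sub_smul_iff (sub_ne_zero.mpr hs), not_not]
    simp [hs]

theorem IsResolventAt.isClosed_realSpec (h : IsResolventAt D t (u : adjointable A E)) :
    IsClosed (realSpec D) := by
  have : realSpec D =
      (fun s : ℝ => 1 - ((s : ℂ) - t) • (u : adjointable A E)) ⁻¹' {w | IsUnit w}ᶜ := by
    ext s
    exact h.mem_spec_iff
  rw [this]
  exact Units.isOpen.isClosed_compl.preimage (by fun_prop)

theorem IsResolventAt.spec_subset (h : IsResolventAt D t (u : adjointable A E))
    (hu : IsSelfAdjoint (u : adjointable A E)) : spec D ⊆ Set.range ((↑) : ℝ → ℂ) := by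
  intro z hz
  rw [h.mem_spec_iff] at hz
  by_contra hne
  refine hz (isUnit_one_sub_smul hu fun him => hne ⟨z.re, ?_⟩)
  exact Complex.ext rfl (by simpa using him.symm)

/-- For `s ≠ t`, a neighbourhood `U` of `s` contains the image of an open interval around
`(s - t)⁻¹` under `r ↦ t + r⁻¹`. -/
theorem exists_Ioo_subset_preimage {s t : ℝ} (hs : s ≠ t) {U : Set ℝ} (hU : U ∈ 𝓝 s) :
    ∃ a b : ℝ, (s - t)⁻¹ ∈ Set.Ioo a b ∧ (0 : ℝ) ∉ Set.Ioo a b ∧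
      ∀ r ∈ Set.Ioo a b, t + r⁻¹ ∈ U := by
  have hr0 : (s - t)⁻¹ ≠ 0 := inv_ne_zero (sub_ne_zero.mpr hs)
  have hc : ContinuousAt (fun r : ℝ => t + r⁻¹) (s - t)⁻¹ :=
    continuousAt_const.add (continuousAt_inv₀ hr0)
  have hmem : U ∈ 𝓝 (t + ((s - t)⁻¹)⁻¹) := by rwa [inv_inv, add_sub_cancel]
  obtain ⟨a, b, hab, hsub⟩ := mem_nhds_iff_exists_Ioo_subset.mp
    (inter_mem (hc hmem) (isOpen_ne.mem_nhds hr0))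
  exact ⟨a, b, hab, fun h => (hsub h).2 rfl, fun r hr => (hsub hr).1⟩

/-- The map `r ↦ t + r⁻¹` is a homeomorphism from the nonzero reals onto the reals other than `t`,
so gaps and non-isolated points are carried over. -/
theorem IsResolventAt.isCantorSet (h : IsResolventAt D t (u : adjointable A E))
    (h1 : ∀ a b : ℝ, a < b → ∃ r ∈ Set.Ioo a b, r ∉ quasispectrum ℝ u)
    (h2 : ∀ a b : ℝ, (0 : ℝ) ∉ Set.Ioo a b → ∀ r, quasispectrum ℝ u ∩ Set.Ioo a b ≠ {r}) :
    IsCantorSet (realSpec D) := by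
  have hback (r : ℝ) : (t + r⁻¹ - t)⁻¹ = r := by rw [add_sub_cancel_left, inv_inv]
  constructor
  · rw [h.isClosed_realSpec.isNowhereDense_iff, Set.eq_empty_iff_forall_notMem]
    intro s hs
    obtain ⟨hst, -⟩ := h.mem_realSpec_iff.mp (interior_subset hs)
    obtain ⟨a, b, hab, -, hsub⟩ :=
      exists_Ioo_subset_preimage hst (isOpen_interior.mem_nhds hs)
    obtain ⟨r, hr, hr'⟩ := h1 a b (hab.1.trans hab.2)
    have := (h.mem_realSpec_iff.mp (interior_subset (hsub r hr))).2
    rw [hback] at this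
    exact hr' this
  · intro s hs
    obtain ⟨hst, hs'⟩ := h.mem_realSpec_iff.mp hs
    rw [accPt_iff_nhds]
    intro U hU
    obtain ⟨a, b, hab, h0, hsub⟩ := exists_Ioo_subset_preimage hst hU
    obtain ⟨r, hr, hne⟩ : ∃ r ∈ quasispectrum ℝ u ∩ Set.Ioo a b, r ≠ (s - t)⁻¹ := by
      by_contra! hall
      exact h2 a b h0 _ (Set.eq_singleton_iff_unique_mem.mpr ⟨⟨hs', hab⟩, hall⟩)
    have hr0 : r ≠ 0 := fun h => h0 (h ▸ hr.2)
    refine ⟨t + r⁻¹, ⟨hsub r hr.2, h.mem_realSpec_iff.mpr ⟨?_, ?_⟩⟩, fun he => hne ?_⟩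
    · simpa using hr0
    · rw [hback]; exact hr.1
    · rw [← he, hback]

end Spectrum

/-- The range of `r * r` is dense, and each `r (r v)` is a limit of vectors `u (c v)`. -/
theorem denseRange_of_mul_self_mem_closure {u r : adjointable A E} (hr : DenseRange r.1)
    (h : ∀ ε > 0, ∃ c : adjointable A E, ‖r * r - u * c‖ < ε) : DenseRange u.1 := by
  have hrr : DenseRange (r * r).1 := hr.comp hr r.1.continuous
  refine dense_closure.mp (hrr.mono ?_)
  rintro _ ⟨v, rfl⟩
  refine Metric.mem_closure_iff.mpr fun ε hε => ?_
  obtain ⟨c, hc⟩ := h (ε / (‖v‖ + 1)) (by positivity)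
  refine ⟨u.1 (c.1 v), ⟨_, rfl⟩, ?_⟩
  rw [dist_eq_norm]
  calc ‖(r * r - u * c).1 v‖ ≤ ‖r * r - u * c‖ * ‖v‖ := (r * r - u * c).1.le_opNorm v
    _ ≤ ‖r * r - u * c‖ * (‖v‖ + 1) := by gcongr; linarith
    _ < ε := (lt_div_iff₀ (by positivity)).mp hc

theorem tendsto_resolvent {u : ℕ → adjointable A E} {u₀ : adjointable A E}
    (hu : Tendsto u atTop (𝓝 u₀)) (z : ℂ) (h : IsUnit (1 - z • u₀)) :
    Tendsto (fun n => u n * Ring.inverse (1 - z • u n)) atTop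
      (𝓝 (u₀ * Ring.inverse (1 - z • u₀))) := by
  have hc : ContinuousAt Ring.inverse (1 - z • u₀) := by
    obtain ⟨w, hw⟩ := h
    exact hw ▸ NormedRing.inverse_continuousAt w
  exact hu.mul (hc.tendsto.comp (tendsto_const_nhds.sub (hu.const_smul z)))

end Operators

end CantorBloch

end

theorem mainTheorem3 {A : Type*} {E : Type*}
    [CStarAlgebra A] [PartialOrder A] [StarOrderedRing A]
    [NormedAddCommGroup E] [NormedSpace ℂ E] [Module A E] [CStarModule A E] [CompleteSpace E]
    (hK : CantorBloch.HasRRI0 (CantorBloch.compactOps A E))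
    (D : E →ₗ.[A] E)
    (hD : CantorBloch.IsSelfAdjointOp D) (hDell : CantorBloch.IsElliptic D)
    (hgap : CantorBloch.realSpec D ≠ Set.univ) :
    ∃ T : ℕ → E →ₗ.[A] E,
      (∀ n, CantorBloch.IsSelfAdjointOp (T n) ∧ CantorBloch.IsElliptic (T n) ∧
        CantorBloch.spec (T n) ⊆ Set.range ((↑) : ℝ → ℂ) ∧
        CantorBloch.IsCantorSet (CantorBloch.realSpec (T n))) ∧
      CantorBloch.NormResolventTendsto T D := by
  obtain ⟨t, ht⟩ := (Set.ne_univ_iff_exists_notMem _).mp hgap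
  obtain ⟨R, hR⟩ : ∃ R, CantorBloch.IsResolventAt D t R := not_not.mp ht
  have hRs : IsSelfAdjoint R := hR.isSelfAdjoint hD
  have hRdense : DenseRange R.1 := by
    rw [DenseRange, hR.range_eq]; exact hD.1
  set r : CantorBloch.compactOps A E := ⟨R, hR.mem_compactOps hD hDell⟩ with hr
  have hrs : IsSelfAdjoint r := Subtype.ext hRs
  choose u hus hur hu1 hu2 hu3 using fun n : ℕ =>
    CantorBloch.exists_cantor_approximation hK r hrs (ε := 1 / ((n : ℝ) + 1)) (by positivity)
  have huL (n : ℕ) : IsSelfAdjoint (u n : CantorBloch.adjointable A E) :=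
    congrArg Subtype.val (hus n)
  have hud (n : ℕ) : DenseRange (u n : CantorBloch.adjointable A E).1 := by
    refine CantorBloch.denseRange_of_mul_self_mem_closure hRdense fun ε hε => ?_
    obtain ⟨c, hc⟩ := hu3 n ε hε
    rw [hrs.star_eq] at hc
    exact ⟨c, hc⟩
  have hinj (n : ℕ) := CantorBloch.injective_of_isSelfAdjoint_of_denseRange (huL n) (hud n)
  have hT (n : ℕ) := CantorBloch.isResolventAt_ofResolvent (hinj n) (t : ℂ)
  -- The approximants are `t + (u n)⁻¹`.
  refine ⟨fun n => CantorBloch.ofResolvent (u n).1 (hinj n) t, fun n => ⟨?_, ?_, ?_, ?_⟩, ?_⟩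
  · exact (hT n).isSelfAdjointOp (huL n) (hud n)
  · exact (hT n).isElliptic (huL n) (hud n) (u n).2
  · exact (hT n).spec_subset (huL n)
  · exact (hT n).isCantorSet (hu1 n) (hu2 n)
  · intro z hz
    have hz' : (z - t).im ≠ 0 := by simpa using hz
    -- Norm convergence at the real point `t` passes to every non-real `z`, because the resolvent at
    -- `z` is a continuous function of the one at `t`.
    refine ⟨_, _, fun n => (hT n).of_isUnit (CantorBloch.isUnit_one_sub_smul (huL n) hz'),
      hR.of_isUnit (CantorBloch.isUnit_one_sub_smul hRs hz'),
      CantorBloch.tendsto_resolvent ?_ _ (CantorBloch.isUnit_one_sub_smul hRs hz')⟩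
    rw [tendsto_iff_norm_sub_tendsto_zero]
    exact squeeze_zero (fun n => norm_nonneg _) (fun n => (hur n).le)
      tendsto_one_div_add_atTop_nhds_zero_nat
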